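/- **Model.** For $n_1,n_2\ge 1$, let $z:[n_1]\to\{1,2\}$ and $z':[n_2]\to\{1,2\}$ be partition functions with membership matrices $Z_1\in\{0,1\}^{n_1\times 2}$, $Z_2\in\{0,1\}^{n_2\times 2}$, where $(Z_1)_{ik}=1$ iff $z(i)=k$ and $(Z_2)_{jk}=1$ iff $z'(j)=k$. For $0<q<p<1$ put $\Pi=(p-q)I_2+q\mathbf 1_2\mathbf 1_2^\top$ and $P=(p_{ij})=Z_1\Pi Z_2^\top$. The symmetric bipartite stochastic block model ($K=L=2$) is the law of a random matrix $A\in\{0,1\}^{n_1\times n_2}$ with independent entries $A_{ij}\sim\mathrm{Bernoulli}(p_{ij})$. Write $p_{\max}=\max_{i,j}p_{ij}$. **Parameter space.** For $c\in(0,1)$, $B>0$ and $\rho\in(0,1)$ let $\Theta=\Theta_{n_1,n_2}(c,B,\rho)$ be the set of all $\theta=(z,z',\Pi)$ with $\Pi$ as above for some $p\in(0,1)$ and $q=cp$, with $p_{\max}=\rho$, and such that, for $\alpha=1+B\sqrt{\log n_1/n_1}$, every community $\mathcal C_k=z^{-1}(k)$, $\mathcal C'_k=z'^{-1}(k)$,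 $k=1,2$, satisfies $$\frac{n_1}{2\alpha}\le|\mathcal C_k|\le\frac{\alpha n_1}{2},\qquad \frac{n_2}{2\alpha}\le|\mathcal C'_k|\le\frac{\alpha n_2}{2}.$$ **Risk.** For $\hat z,z:[n_1]\to\{1,2\}$ let $r(\hat z,z)=\frac1{n_1}\min_{\pi\in\mathfrak S_2}\#\{i\in[n_1]:\hat z(i)\ne\pi(z(i))\}$, and let $$R^*_{n_1,n_2}(c,B,\rho)=\inf_{\hat z}\ \sup_{\theta\in\Theta_{n_1,n_2}(c,B,\rho)}\mathbb E_\theta\, r(\hat z(A),z),$$ where the infimum is over all measurable functions $\hat z$ of $A$ with values in $\{1,2\}^{[n_1]}$. **Theorem.** 1. There is a universal constant $c_1>0$ such that the following holds. Let $c\in(0,1)$ and $B>0$ be fixed, and let $n_1=n_1(m)$, $n_2=n_2(m)$ and $p_{\max}=p_{\max}(m)\in(0,1)$ be sequences such that, as $m\to\infty$, $n_1\log n_1=o(n_2)$, $n_1n_2p_{\max}^2\to\infty$ and $n_1n_2p_{\max}^2=O(\log n_1)$. Then for all sufficiently large $m$, $$R^*_{n_1,n_2}(c,B,p_{\max})\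 \ge\ \exp\left(-c_1\,n_1n_2p_{\max}^2\right).$$ 2. For all $0<a\le b$ there is a constant $c_2>0$, depending only on $a$ and $b$, such that the following holds. Let $c\in(0,1)$ and $B>0$ be fixed, and let $n_1=n_1(m)$, $n_2=n_2(m)$ and $p_{\max}=p_{\max}(m)\in(0,1)$ be sequences such that $n_1\to\infty$ and $n_1\log n_1=o(n_2)$ as $m\to\infty$, and $a\le n_1n_2p_{\max}^2\le b$ for all sufficiently large $m$. Then for all sufficiently large $m$, $$R^*_{n_1,n_2}(c,B,p_{\max})\ \ge\ c_2 .$$ -/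

import Mathlib

open MeasureTheory ProbabilityTheory Filter Topology Asymptotics

noncomputable section

namespace BiSBM

/-- The `n × K` membership matrix of a partition function `z : [n] → [K]`. -/
def membership {n K : ℕ} (z : Fin n → Fin K) : Matrix (Fin n) (Fin K) ℝ :=
  Matrix.of fun i k => if z i = k then 1 else 0

/-- Parameters of a bipartite stochastic block model: row labels, column labels, and the
connectivity matrix. -/
structure Param (K L n₁ n₂ : ℕ) where
  z : Fin n₁ → Fin K
  z' : Fin n₂ → Fin L
  conn : Matrix (Fin K) (Fin L) ℝ

/-- The matrix of edge probabilities `P = Z₁ Π Z₂ᵀ`. -/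
def Param.edgeProb {K L n₁ n₂ : ℕ} (θ : Param K L n₁ n₂) : Matrix (Fin n₁) (Fin n₂) ℝ :=
  membership θ.z * θ.conn * (membership θ.z').transpose

/-- The largest edge probability `p_max = max_{i,j} p_{ij}`. -/
def Param.pmax {K L n₁ n₂ : ℕ} (θ : Param K L n₁ n₂) : ℝ :=
  ⨆ ij : Fin n₁ × Fin n₂, θ.edgeProb ij.1 ij.2

/-- A bipartite graph on `[n₁] ⊔ [n₂]`, given by its adjacency matrix (`true` stands for `1`). -/
abbrev Graph (n₁ n₂ : ℕ) : Type := Fin n₁ → Fin n₂ → Bool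

/-- The law of the adjacency matrix: independent Bernoulli entries of parameters `p_{ij}`.
(The projection onto `[0,1]` does nothing when the entries of `P` are probabilities.) -/
def Param.law {K L n₁ n₂ : ℕ} (θ : Param K L n₁ n₂) : Measure (Graph n₁ n₂) :=
  Measure.pi fun i => Measure.pi fun j =>
    bernoulliMeasure true false (Set.projIcc (0 : ℝ) 1 zero_le_one (θ.edgeProb i j))

/-- The symmetric connectivity matrix `(p - q) I + q 1 1ᵀ`. -/
def symmConn (K : ℕ) (p q : ℝ) : Matrix (Fin K) (Fin K) ℝ :=
  (p - q) • (1 : Matrix (Fin K) (Fin K) ℝ) + q • Matrix.of fun _ _ => (1 : ℝ)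

/-- Every one of the `K` communities of `z` has size between `n / (α K)` and `α n / K`. -/
def Balanced {n K : ℕ} (α : ℝ) (z : Fin n → Fin K) : Prop :=
  ∀ k : Fin K,
    (n : ℝ) / (α * K) ≤ ((Finset.univ.filter fun i => z i = k).card : ℝ) ∧
      ((Finset.univ.filter fun i => z i = k).card : ℝ) ≤ α * n / K

/-- The admissible parameters of the symmetric model with `q = c p`, balance parameter `α`, and
sparsity level `p_max = ρ`. -/
def admissible (K n₁ n₂ : ℕ) (c α ρ : ℝ) : Set (Param K K n₁ n₂) :=
  {θ | (∃ p : ℝ, 0 < p ∧ p < 1 ∧ θ.conn = symmConn K p (c * p)) ∧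
    Balanced α θ.z ∧ Balanced α θ.z' ∧ θ.pmax = ρ}

/-- The misclustering rate
`r(ẑ, z) = (1/n) min_π #{i : ẑ(i) ≠ π(z(i))}`, over permutations `π` of the labels. -/
def misclust {n K : ℕ} (zhat z : Fin n → Fin K) : ℝ :=
  (1 / (n : ℝ)) * ((Finset.univ : Finset (Equiv.Perm (Fin K))).inf' Finset.univ_nonempty
    fun π => (Finset.univ.filter fun i => zhat i ≠ π (z i)).card : ℕ)

/-- The expected misclustering rate of the estimator `zhat` when `A` follows the model `θ`. -/
def risk {K L n₁ n₂ : ℕ} (zhat : Graph n₁ n₂ → Fin n₁ → Fin K) (θ : Param K L n₁ n₂) : ℝ :=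
  ∫ A, misclust (zhat A) θ.z ∂θ.law

/-- The minimax risk. All functions of `A` are measurable, since there are finitely many graphs.
Risks lie in `[0,1]`, so the supremum and the infimum are those of bounded families. -/
def minimaxRisk (K n₁ n₂ : ℕ) (c α ρ : ℝ) : ℝ :=
  ⨅ zhat : Graph n₁ n₂ → Fin n₁ → Fin K,
    ⨆ θ : admissible K n₁ n₂ c α ρ, risk zhat θ.1

/-- The balance parameter `α = 1 + B √(log n₁ / n₁)`. -/
def balanceParam (B : ℝ) (n₁ : ℕ) : ℝ :=
  1 + B * Real.sqrt (Real.log n₁ / n₁)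

end BiSBM

end

noncomputable section

namespace BiSBM

/-- The mass function of the Bernoulli law of parameter `x`. -/
def bern (x : ℝ) (b : Bool) : ℝ := if b then x else 1 - x

lemma bern_nonneg {x : ℝ} (h0 : 0 ≤ x) (h1 : x ≤ 1) (b : Bool) : 0 ≤ bern x b := by
  cases b <;> simp [bern] <;> linarith

lemma sum_bern (x : ℝ) : ∑ b, bern x b = 1 := by simp [bern]

lemma sum_pi_prod {ι κ : Type*} [Fintype ι] [DecidableEq ι] [Fintype κ] (g : ι → κ → ℝ) :
    ∑ v : ι → κ, ∏ i, g i (v i) = ∏ i, ∑ b, g i b := by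
  rw [Finset.prod_univ_sum, Fintype.piFinset_univ]

lemma one_sub_le_bern_affinity {x y p : ℝ} (hx0 : 0 ≤ x) (hx1 : x ≤ 1) (hy0 : 0 ≤ y)
    (hp0 : 0 ≤ p) (hp1 : p ≤ 1) (h : (x ≤ p ∧ y ≤ p) ∨ x = y) :
    1 - p ≤ ∑ b, √(bern x b * bern y b) := by
  simp only [Fintype.sum_bool, bern, if_true, Bool.false_eq_true, if_false]
  rcases h with ⟨hx, hy⟩ | rfl
  · have h1 : 1 - p ≤ √((1 - x) * (1 - y)) := by
      apply Real.le_sqrt_of_sq_le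
      nlinarith
    linarith [Real.sqrt_nonneg (x * y)]
  · rw [Real.sqrt_mul_self hx0, Real.sqrt_mul_self (by linarith)]
    linarith

/-- The squared Hellinger distance between `α x + β y` and `β x + α y` contracts. -/
lemma sq_sqrt_sub_sqrt_le {α β x y : ℝ} (hα : 0 ≤ α) (hβ : 0 ≤ β) (hx : 0 ≤ x) (hy : 0 ≤ y) :
    (√(α * x + β * y) - √(β * x + α * y)) ^ 2 ≤ |α - β| * (√x - √y) ^ 2 := by
  have key : ∀ {α β : ℝ}, 0 ≤ β → β ≤ α →
      (√(α * x + β * y) - √(β * x + α * y)) ^ 2 ≤ (α - β) * (√x - √y) ^ 2 := by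
    intro α β hβ hαβ
    have hα : 0 ≤ α := hβ.trans hαβ
    obtain ⟨X, hX, rfl⟩ : ∃ X, 0 ≤ X ∧ x = X ^ 2 := ⟨√x, Real.sqrt_nonneg x, (Real.sq_sqrt hx).symm⟩
    obtain ⟨Y, hY, rfl⟩ : ∃ Y, 0 ≤ Y ∧ y = Y ^ 2 := ⟨√y, Real.sqrt_nonneg y, (Real.sq_sqrt hy).symm⟩
    rw [Real.sqrt_sq hX, Real.sqrt_sq hY]
    have hu : 0 ≤ α * X ^ 2 + β * Y ^ 2 := by positivity
    have hw : 0 ≤ β * X ^ 2 + α * Y ^ 2 := by positivity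
    have h1 : β * (X ^ 2 + Y ^ 2) + (α - β) * (X * Y) ≤
        √(α * X ^ 2 + β * Y ^ 2) * √(β * X ^ 2 + α * Y ^ 2) := by
      rw [← Real.sqrt_mul hu]
      apply Real.le_sqrt_of_sq_le
      have h2 : 0 ≤ β * (α - β) * (X ^ 2 + Y ^ 2) * (X - Y) ^ 2 :=
        mul_nonneg (mul_nonneg (mul_nonneg hβ (by linarith)) (by positivity)) (sq_nonneg _)
      nlinarith
    nlinarith [Real.sq_sqrt hu, Real.sq_sqrt hw]
  rcases le_total β α with h | h
  · rw [abs_of_nonneg (by linarith)]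
    exact key hβ h
  · rw [abs_of_nonpos (by linarith), neg_sub, sub_sq_comm]
    exact key hα h

lemma sum_sqrt_mul_eq {V : Type*} [Fintype V] {P Q : V → ℝ} (hP : ∀ v, 0 ≤ P v)
    (hQ : ∀ v, 0 ≤ Q v) (hP1 : ∑ v, P v = 1) (hQ1 : ∑ v, Q v = 1) :
    ∑ v, √(P v * Q v) = 1 - (∑ v, (√(P v) - √(Q v)) ^ 2) / 2 := by
  have h : ∀ v, (√(P v) - √(Q v)) ^ 2 = P v + Q v - 2 * √(P v * Q v) := fun v => by
    rw [sub_sq, Real.sq_sqrt (hP v), Real.sq_sqrt (hQ v), Real.sqrt_mul (hP v)]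
    ring
  simp_rw [h, Finset.sum_sub_distrib, Finset.sum_add_distrib, ← Finset.mul_sum, hP1, hQ1]
  ring

/-- Le Cam's bound of the testing affinity by the Bhattacharyya coefficient. -/
lemma sq_sum_sqrt_le_sum_min {V : Type*} [Fintype V] {P Q : V → ℝ} (hP : ∀ v, 0 ≤ P v)
    (hQ : ∀ v, 0 ≤ Q v) (hP1 : ∑ v, P v = 1) (hQ1 : ∑ v, Q v = 1) :
    (∑ v, √(P v * Q v)) ^ 2 / 2 ≤ ∑ v, min (P v) (Q v) := by
  have h0 : ∀ v, √(P v * Q v) = √(min (P v) (Q v)) * √(max (P v) (Q v)) := fun v => by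
    rw [← Real.sqrt_mul (le_min (hP v) (hQ v)), min_mul_max]
  have h1 : (∑ v, √(P v * Q v)) ^ 2 ≤ (∑ v, min (P v) (Q v)) * ∑ v, max (P v) (Q v) := by
    simp_rw [h0]
    refine (Finset.sum_mul_sq_le_sq_mul_sq _ _ _).trans_eq ?_
    simp_rw [Real.sq_sqrt (le_min (hP _) (hQ _)), Real.sq_sqrt (le_max_of_le_left (hP _))]
  have h2 : ∑ v, max (P v) (Q v) ≤ 2 := by
    calc ∑ v, max (P v) (Q v) ≤ ∑ v, (P v + Q v) :=
          Finset.sum_le_sum fun v _ => max_le (by linarith [hQ v]) (by linarith [hP v])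
      _ = 2 := by rw [Finset.sum_add_distrib, hP1, hQ1]; norm_num
  have h3 : 0 ≤ ∑ v, min (P v) (Q v) := Finset.sum_nonneg fun v _ => le_min (hP v) (hQ v)
  nlinarith

/-- The law of one column of the adjacency matrix when its label is uniform. -/
def colLaw {n : ℕ} (p q : ℝ) (z : Fin n → Fin 2) (v : Fin n → Bool) : ℝ :=
  (∑ l : Fin 2, ∏ i, bern (if z i = l then p else q) (v i)) / 2

lemma colLaw_nonneg {n : ℕ} {p q : ℝ} (hq : 0 ≤ q) (hqp : q ≤ p) (hp : p ≤ 1)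
    (z : Fin n → Fin 2) (v : Fin n → Bool) : 0 ≤ colLaw p q z v := by
  refine div_nonneg (Finset.sum_nonneg fun l _ => Finset.prod_nonneg fun i _ => ?_) zero_le_two
  split_ifs <;> exact bern_nonneg (by linarith) (by linarith) _

lemma sum_colLaw {n : ℕ} (p q : ℝ) (z : Fin n → Fin 2) : ∑ v, colLaw p q z v = 1 := by
  unfold colLaw
  rw [← Finset.sum_div, Finset.sum_comm]
  have h : ∀ l, ∑ v : Fin n → Bool, ∏ i, bern (if z i = l then p else q) (v i) = 1 := fun l => by
    rw [sum_pi_prod (fun i b => bern (if z i = l then p else q) b)]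
    simp only [sum_bern, Finset.prod_const_one]
  simp [h]

/-- Exchanging the labels of two rows moves the law of a column by `O(n p²)`. -/
lemma one_sub_le_colLaw_affinity {n : ℕ} {p q : ℝ} (hq : 0 ≤ q) (hqp : q ≤ p) (hp : p ≤ 1)
    {z w : Fin n → Fin 2} {a b : Fin n} (hzab : z a ≠ z b) (hwa : w a = z b) (hwb : w b = z a)
    (hw : ∀ i, i ≠ a → i ≠ b → w i = z i) :
    1 - 2 * n * p ^ 2 ≤ ∑ v, √(colLaw p q z v * colLaw p q w v) := by
  have hab : a ≠ b := fun h => hzab (h ▸ rfl)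
  have hp0 : 0 ≤ p := hq.trans hqp
  set x : Fin 2 → Fin n → ℝ := fun l i =>
    if i = a ∨ i = b then 1 / 2 else if z i = l then p else q with hx
  have hx0 : ∀ l i, 0 ≤ x l i := fun l i => by
    simp only [hx]; split_ifs <;> linarith
  have hx1 : ∀ l i, x l i ≤ 1 := fun l i => by
    simp only [hx]; split_ifs <;> linarith
  set u : Fin 2 → (Fin n → Bool) → ℝ := fun l v => ∏ i, bern (x l i) (v i) with hu
  have hu0 : ∀ l v, 0 ≤ u l v := fun l v =>
    Finset.prod_nonneg fun i _ => bern_nonneg (hx0 l i) (hx1 l i) _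
  have hu1 : ∀ l, ∑ v, u l v = 1 := fun l => by
    simp only [hu]
    rw [sum_pi_prod (fun i b => bern (x l i) b)]
    simp only [sum_bern, Finset.prod_const_one]
  have hfac : ∀ y : Fin n → Fin 2, (∀ i, i ≠ a → i ≠ b → y i = z i) → ∀ l v,
      ∏ i, bern (if y i = l then p else q) (v i) =
        4 * bern (if y a = l then p else q) (v a) * bern (if y b = l then p else q) (v b) *
          u l v := by
    intro y hy l v
    have h1 : ∀ i, bern (if y i = l then p else q) (v i) =
        (if i = a ∨ i = b then 2 * bern (if y i = l then p else q) (v i) else 1) *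
          bern (x l i) (v i) := by
      intro i
      by_cases hi : i = a ∨ i = b
      · simp only [hx, hi, if_true]
        cases v i <;> simp only [bern, if_true, Bool.false_eq_true, if_false] <;> ring
      · push Not at hi
        simp [hx, hi.1, hi.2, hy i hi.1 hi.2]
    rw [Finset.prod_congr rfl fun i _ => h1 i, Finset.prod_mul_distrib,
      Fintype.prod_eq_mul a b hab (fun i hi => by simp [hi.1, hi.2])]
    simp only [true_or, or_true, if_true, hu]
    ring
  have hpq : ∀ c d : Bool, |2 * (bern p c * bern q d) - 2 * (bern q c * bern p d)| ≤ 2 * p := by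
    intro c d
    cases c <;> cases d <;> simp only [bern, if_true, Bool.false_eq_true, if_false] <;>
      rw [abs_le] <;> constructor <;> nlinarith
  have hB : ∀ c, 0 ≤ bern p c ∧ 0 ≤ bern q c := fun c =>
    ⟨bern_nonneg hp0 hp c, bern_nonneg hq (hqp.trans hp) c⟩
  have hdist : ∀ v, (√(colLaw p q z v) - √(colLaw p q w v)) ^ 2 ≤
      2 * p * (√(u 0 v) - √(u 1 v)) ^ 2 := by
    intro v
    have hz := hfac z (fun _ _ _ => rfl)
    have hw' := hfac w hw
    have hcases : (z a = 0 ∧ z b = 1) ∨ (z a = 1 ∧ z b = 0) := by omega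
    have hm : ∀ c d c' d', 0 ≤ 2 * (bern p c * bern q d) ∧ 0 ≤ 2 * (bern q c' * bern p d') :=
      fun c d c' d' => ⟨by have := hB c; have := hB d; positivity [mul_nonneg (hB c).1 (hB d).2],
        by positivity [mul_nonneg (hB c').2 (hB d').1]⟩
    simp only [colLaw, Fin.sum_univ_two, hz, hw', hwa, hwb]
    rcases hcases with ⟨h1, h2⟩ | ⟨h1, h2⟩
    · rw [h1, h2]
      have := sq_sqrt_sub_sqrt_le (hm (v a) (v b) (v a) (v b)).1 (hm (v a) (v b) (v a) (v b)).2
        (hu0 0 v) (hu0 1 v)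
      refine le_trans (le_of_eq ?_) (this.trans
        (mul_le_mul_of_nonneg_right (hpq _ _) (sq_nonneg _)))
      simp only [zero_ne_one, one_ne_zero, if_true, if_false]
      congr 3 <;> ring
    · rw [h1, h2]
      have := sq_sqrt_sub_sqrt_le (hm (v a) (v b) (v a) (v b)).2 (hm (v a) (v b) (v a) (v b)).1
        (hu0 0 v) (hu0 1 v)
      rw [abs_sub_comm] at this
      refine le_trans (le_of_eq ?_) (this.trans
        (mul_le_mul_of_nonneg_right (hpq _ _) (sq_nonneg _)))
      simp only [zero_ne_one, one_ne_zero, if_true, if_false]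
      congr 3 <;> ring
  have haff : 1 - n * p ≤ ∑ v, √(u 0 v * u 1 v) := by
    have h1 : ∀ v, √(u 0 v * u 1 v) = ∏ i, √(bern (x 0 i) (v i) * bern (x 1 i) (v i)) := by
      intro v
      simp only [hu]
      rw [← Finset.prod_mul_distrib, Real.sqrt_prod]
      exact fun i _ => mul_nonneg (bern_nonneg (hx0 0 i) (hx1 0 i) _)
        (bern_nonneg (hx0 1 i) (hx1 1 i) _)
    simp_rw [h1]
    rw [sum_pi_prod (fun i b => √(bern (x 0 i) b * bern (x 1 i) b))]
    calc 1 - n * p ≤ (1 - p) ^ n := by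
          have := one_add_mul_le_pow (show -2 ≤ -p by linarith) n
          rw [← sub_eq_add_neg] at this
          linarith
      _ = ∏ _i : Fin n, (1 - p) := by simp
      _ ≤ _ := Finset.prod_le_prod (fun i _ => by linarith) fun i _ =>
          one_sub_le_bern_affinity (hx0 0 i) (hx1 0 i) (hx0 1 i) hp0 hp (by
            simp only [hx]
            split_ifs
            all_goals first | exact Or.inr rfl | exact Or.inl ⟨by linarith, by linarith⟩)
  rw [sum_sqrt_mul_eq (colLaw_nonneg hq hqp hp z) (colLaw_nonneg hq hqp hp w) (sum_colLaw p q z)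
    (sum_colLaw p q w)]
  rw [sum_sqrt_mul_eq (hu0 0) (hu0 1) (hu1 0) (hu1 1)] at haff
  have h2 : ∑ v, (√(colLaw p q z v) - √(colLaw p q w v)) ^ 2 ≤
      2 * p * ∑ v, (√(u 0 v) - √(u 1 v)) ^ 2 := by
    rw [Finset.mul_sum]
    exact Finset.sum_le_sum fun v _ => hdist v
  nlinarith [mul_le_mul_of_nonneg_left haff hp0]

lemma Param.edgeProb_apply {K L n₁ n₂ : ℕ} (θ : Param K L n₁ n₂) (i : Fin n₁) (j : Fin n₂) :
    θ.edgeProb i j = θ.conn (θ.z i) (θ.z' j) := by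
  simp [Param.edgeProb, membership, Matrix.mul_apply]

lemma symmConn_apply {K : ℕ} (p q : ℝ) (k l : Fin K) :
    symmConn K p q k l = if k = l then p else q := by
  simp only [symmConn, Matrix.add_apply, Matrix.smul_apply, Matrix.one_apply, Matrix.of_apply,
    smul_eq_mul]
  split_ifs <;> ring

/-- The parameter of the symmetric two-community model with given labels. -/
def symmParam {n₁ n₂ : ℕ} (p q : ℝ) (z : Fin n₁ → Fin 2) (z' : Fin n₂ → Fin 2) :
    Param 2 2 n₁ n₂ :=
  ⟨z, z', symmConn 2 p q⟩

lemma symmParam_edgeProb {n₁ n₂ : ℕ} (p q : ℝ) (z : Fin n₁ → Fin 2) (z' : Fin n₂ → Fin 2)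
    (i : Fin n₁) (j : Fin n₂) :
    (symmParam p q z z').edgeProb i j = if z i = z' j then p else q := by
  rw [Param.edgeProb_apply]
  exact symmConn_apply _ _ _ _

instance {K L n₁ n₂ : ℕ} (θ : Param K L n₁ n₂) : IsProbabilityMeasure θ.law := by
  unfold Param.law
  infer_instance

lemma bernoulliMeasure_real_singleton {x : ℝ} (h0 : 0 ≤ x) (h1 : x ≤ 1) (b : Bool) :
    (bernoulliMeasure true false (Set.projIcc (0 : ℝ) 1 zero_le_one x)).real {b} = bern x b := by
  rw [Set.projIcc_of_mem zero_le_one ⟨h0, h1⟩,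
    bernoulliMeasure_real_apply _ (MeasurableSet.singleton b)]
  cases b <;> simp [bern]

lemma Param.law_real_singleton {K L n₁ n₂ : ℕ} (θ : Param K L n₁ n₂)
    (h : ∀ i j, 0 ≤ θ.edgeProb i j ∧ θ.edgeProb i j ≤ 1) (A : Graph n₁ n₂) :
    θ.law.real {A} = ∏ i, ∏ j, bern (θ.edgeProb i j) (A i j) := by
  rw [Measure.real, Param.law, Measure.pi_singleton, ENNReal.toReal_prod]
  refine Finset.prod_congr rfl fun i _ => ?_
  rw [Measure.pi_singleton, ENNReal.toReal_prod]
  exact Finset.prod_congr rfl fun j _ => bernoulliMeasure_real_singleton (h i j).1 (h i j).2 _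

lemma misclust_nonneg {n K : ℕ} (y z : Fin n → Fin K) : 0 ≤ misclust y z := by
  unfold misclust
  positivity

lemma misclust_le_one {n K : ℕ} (y z : Fin n → Fin K) : misclust y z ≤ 1 := by
  unfold misclust
  have h : ((Finset.univ : Finset (Equiv.Perm (Fin K))).inf' Finset.univ_nonempty
      fun π => (Finset.univ.filter fun i => y i ≠ π (z i)).card) ≤ n :=
    (Finset.inf'_le _ (Finset.mem_univ 1)).trans ((Finset.card_filter_le _ _).trans (by simp))
  rcases Nat.eq_zero_or_pos n with rfl | hn
  · simp
  · rw [one_div, inv_mul_le_one₀ (by exact_mod_cast hn)]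
    exact_mod_cast h

lemma risk_eq_sum {K L n₁ n₂ : ℕ} (zhat : Graph n₁ n₂ → Fin n₁ → Fin K) (θ : Param K L n₁ n₂) :
    risk zhat θ = ∑ A, θ.law.real {A} * misclust (zhat A) θ.z := by
  unfold risk
  rw [integral_fintype Integrable.of_finite]
  simp only [smul_eq_mul]

lemma risk_nonneg {K L n₁ n₂ : ℕ} (zhat : Graph n₁ n₂ → Fin n₁ → Fin K) (θ : Param K L n₁ n₂) :
    0 ≤ risk zhat θ :=
  integral_nonneg fun _ => misclust_nonneg _ _

lemma risk_le_one {K L n₁ n₂ : ℕ} (zhat : Graph n₁ n₂ → Fin n₁ → Fin K) (θ : Param K L n₁ n₂) :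
    risk zhat θ ≤ 1 := by
  unfold risk
  refine (integral_mono Integrable.of_finite (integrable_const (1 : ℝ))
    fun A => misclust_le_one _ _).trans_eq ?_
  simp

/-- The law of the adjacency matrix when the column labels are independent and uniform. -/
def graphLaw {n₁ n₂ : ℕ} (p q : ℝ) (z : Fin n₁ → Fin 2) (A : Graph n₁ n₂) : ℝ :=
  ∏ j, colLaw p q z fun i => A i j

lemma sum_prod_columns {n₁ n₂ : ℕ} (f : (Fin n₁ → Bool) → ℝ) :
    ∑ A : Graph n₁ n₂, ∏ j, f (fun i => A i j) = (∑ v, f v) ^ n₂ := by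
  rw [← (Equiv.piComm fun (_ : Fin n₂) (_ : Fin n₁) => Bool).sum_comp]
  exact (sum_pi_prod fun (_ : Fin n₂) v => f v).trans (by simp)

lemma graphLaw_nonneg {n₁ n₂ : ℕ} {p q : ℝ} (hq : 0 ≤ q) (hqp : q ≤ p) (hp : p ≤ 1)
    (z : Fin n₁ → Fin 2) (A : Graph n₁ n₂) : 0 ≤ graphLaw p q z A :=
  Finset.prod_nonneg fun _ _ => colLaw_nonneg hq hqp hp z _

lemma sum_graphLaw {n₁ n₂ : ℕ} (p q : ℝ) (z : Fin n₁ → Fin 2) :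
    ∑ A : Graph n₁ n₂, graphLaw p q z A = 1 := by
  unfold graphLaw
  rw [sum_prod_columns (colLaw p q z), sum_colLaw, one_pow]

lemma sum_law_symmParam {n₁ n₂ : ℕ} {p q : ℝ} (hq : 0 ≤ q) (hqp : q ≤ p) (hp : p ≤ 1)
    (z : Fin n₁ → Fin 2) (A : Graph n₁ n₂) :
    ∑ z' : Fin n₂ → Fin 2, (symmParam p q z z').law.real {A} = 2 ^ n₂ * graphLaw p q z A := by
  have h : ∀ z' : Fin n₂ → Fin 2, (symmParam p q z z').law.real {A} =
      ∏ j, ∏ i, bern (if z i = z' j then p else q) (A i j) := fun z' => by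
    rw [Param.law_real_singleton, Finset.prod_comm]
    · simp_rw [symmParam_edgeProb]
    · intro i j
      rw [symmParam_edgeProb]
      split_ifs <;> constructor <;> linarith
  simp_rw [h]
  rw [sum_pi_prod fun j l => ∏ i, bern (if z i = l then p else q) (A i j)]
  have h2 : (2 : ℝ) ^ n₂ = ∏ _j : Fin n₂, 2 := by simp
  rw [h2, graphLaw, ← Finset.prod_mul_distrib]
  refine Finset.prod_congr rfl fun j _ => ?_
  rw [colLaw]
  ring

lemma exp_neg_two_mul_le {y : ℝ} (h0 : 0 ≤ y) (h1 : y ≤ 1 / 2) : Real.exp (-(2 * y)) ≤ 1 - y := by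
  rw [Real.exp_neg]
  refine inv_le_of_inv_le₀ (by linarith) (le_trans ?_ (Real.add_one_le_exp _))
  rw [inv_le_iff_one_le_mul₀ (by linarith)]
  nlinarith

lemma exp_le_sum_min_graphLaw {n₁ n₂ : ℕ} {p q : ℝ} (hq : 0 ≤ q) (hqp : q ≤ p) (hp : p ≤ 1)
    (hsmall : n₁ * p ^ 2 ≤ 1 / 4)
    {z w : Fin n₁ → Fin 2} {a b : Fin n₁} (hzab : z a ≠ z b) (hwa : w a = z b) (hwb : w b = z a)
    (hw : ∀ i, i ≠ a → i ≠ b → w i = z i) :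
    Real.exp (-8 * (n₁ * n₂ * p ^ 2)) / 2 ≤
      ∑ A : Graph n₁ n₂, min (graphLaw p q z A) (graphLaw p q w A) := by
  have h1 : ∀ A : Graph n₁ n₂, √(graphLaw p q z A * graphLaw p q w A) =
      ∏ j, √(colLaw p q z (fun i => A i j) * colLaw p q w (fun i => A i j)) := fun A => by
    rw [graphLaw, graphLaw, ← Finset.prod_mul_distrib, Real.sqrt_prod]
    exact fun j _ => mul_nonneg (colLaw_nonneg hq hqp hp z _) (colLaw_nonneg hq hqp hp w _)
  have h2 : Real.exp (-4 * (n₁ * n₂ * p ^ 2)) ≤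
      ∑ A : Graph n₁ n₂, √(graphLaw p q z A * graphLaw p q w A) := by
    simp_rw [h1]
    rw [sum_prod_columns fun v => √(colLaw p q z v * colLaw p q w v)]
    have h3 : Real.exp (-(2 * (2 * n₁ * p ^ 2))) ≤ ∑ v, √(colLaw p q z v * colLaw p q w v) :=
      (exp_neg_two_mul_le (by positivity) (by linarith)).trans
        (one_sub_le_colLaw_affinity hq hqp hp hzab hwa hwb hw)
    refine le_trans (le_of_eq ?_) (pow_le_pow_left₀ (Real.exp_pos _).le h3 n₂)
    rw [← Real.exp_nat_mul]
    ring_nf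
  refine le_trans ?_ (sq_sum_sqrt_le_sum_min (graphLaw_nonneg hq hqp hp z)
    (graphLaw_nonneg hq hqp hp w) (sum_graphLaw p q z) (sum_graphLaw p q w))
  have h4 : Real.exp (-8 * (n₁ * n₂ * p ^ 2)) = Real.exp (-4 * (n₁ * n₂ * p ^ 2)) ^ 2 := by
    rw [← Real.exp_nat_mul]
    ring_nf
  rw [h4]
  gcongr

/-- An estimator can be aligned with labels that are known on a large set `F` of rows, so that the
misclustering rate controls the errors made on a smaller set of rows. -/
lemma exists_aligned {n t : ℕ} (y f : Fin n → Fin 2) (F : Finset (Fin n)) (hF : 2 * t ≤ F.card)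
    {a : Fin t → Fin n} (ha : Function.Injective a) :
    ∃ w : Fin n → Fin 2, ∀ z : Fin n → Fin 2, (∀ i ∈ F, z i = f i) →
      ((Finset.univ.filter fun k => w (a k) ≠ z (a k)).card : ℝ) ≤ n * misclust y z := by
  rcases Nat.eq_zero_or_pos n with rfl | hn
  · refine ⟨y, fun z _ => ?_⟩
    have : IsEmpty (Fin t) := ⟨fun k => (a k).elim0⟩
    simp
  have hperm : ∀ π σ : Equiv.Perm (Fin 2), π ≠ σ → ∀ x, π x ≠ σ x := by decide
  obtain ⟨σ, -, hσ⟩ := Finset.exists_min_image (Finset.univ : Finset (Equiv.Perm (Fin 2)))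
    (fun π => (F.filter fun i => y i ≠ π (f i)).card) Finset.univ_nonempty
  refine ⟨fun i => σ.symm (y i), fun z hz => ?_⟩
  have hn' : (n : ℝ) ≠ 0 := by positivity
  rw [misclust, ← mul_assoc, mul_one_div_cancel hn', one_mul, Nat.cast_le, Finset.le_inf'_iff]
  intro π _
  by_cases h : π = σ
  · subst h
    refine Finset.card_le_card_of_injOn a (fun k hk => ?_) ha.injOn
    simp only [Finset.mem_coe, Finset.mem_filter, Finset.mem_univ, true_and] at hk ⊢
    exact fun h' => hk (by rw [h', Equiv.symm_apply_apply])
  · have h1 : F.card ≤ (F.filter fun i => y i ≠ π (f i)).card +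
        (F.filter fun i => y i ≠ σ (f i)).card := by
      refine le_trans (Finset.card_le_card fun i hi => ?_) (Finset.card_union_le _ _)
      simp only [Finset.mem_union, Finset.mem_filter, hi, true_and]
      by_contra! h'
      exact hperm π σ h (f i) (h'.1.symm.trans h'.2)
    have h2 := hσ π (Finset.mem_univ _)
    have h3 : (F.filter fun i => y i ≠ π (f i)).card ≤
        (Finset.univ.filter fun i => y i ≠ π (z i)).card := by
      refine Finset.card_le_card fun i hi => ?_
      rw [Finset.mem_filter] at hi ⊢
      exact ⟨Finset.mem_univ _, by rw [hz i hi.1]; exact hi.2⟩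
    have h4 : (Finset.univ.filter fun k => σ.symm (y (a k)) ≠ z (a k)).card ≤ t :=
      (Finset.card_filter_le _ _).trans (by simp)
    refine h4.trans ?_
    omega

lemma sum_sign_label {m : ℕ} (z : Fin m → Fin 2) (k : Fin 2) :
    ∑ j, (if z j = k then (1 : ℝ) else -1) =
      2 * ((Finset.univ.filter fun j => z j = k).card : ℝ) - m := by
  have h : ∀ j, (if z j = k then (1 : ℝ) else -1) = 2 * (if z j = k then 1 else 0) - 1 := fun j => by
    split_ifs <;> norm_num
  simp_rw [h, Finset.sum_sub_distrib, ← Finset.mul_sum, Finset.sum_boole]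
  simp

/-- Chernoff's bound for the size of a community of uniform labels. -/
lemma card_large_community_le {m : ℕ} (τ : ℝ) (hτ : 0 ≤ τ) (k : Fin 2) :
    ((Finset.univ.filter fun z : Fin m → Fin 2 =>
      τ * m ≤ ∑ j, (if z j = k then (1 : ℝ) else -1)).card : ℝ) ≤
      2 ^ m * Real.exp (-(τ ^ 2 * m / 2)) := by
  set S : (Fin m → Fin 2) → ℝ := fun z => ∑ j, (if z j = k then (1 : ℝ) else -1) with hS
  have h1 : ∑ z : Fin m → Fin 2, Real.exp (τ * S z) ≤ 2 ^ m * Real.exp (τ ^ 2 * m / 2) := by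
    have h2 : ∀ z : Fin m → Fin 2, Real.exp (τ * S z) =
        ∏ j, Real.exp (τ * (if z j = k then (1 : ℝ) else -1)) := fun z => by
      rw [← Real.exp_sum, ← Finset.mul_sum]
    simp_rw [h2]
    rw [sum_pi_prod fun (_ : Fin m) l => Real.exp (τ * (if l = k then (1 : ℝ) else -1))]
    have h3 : ∑ l : Fin 2, Real.exp (τ * (if l = k then (1 : ℝ) else -1)) = 2 * Real.cosh τ := by
      rw [Real.cosh_eq, Fin.sum_univ_two]
      fin_cases k <;> simp <;> ring
    rw [h3, Finset.prod_const, Finset.card_univ, Fintype.card_fin, mul_pow]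
    refine mul_le_mul_of_nonneg_left ?_ (by positivity)
    refine (pow_le_pow_left₀ (Real.cosh_pos τ).le (Real.cosh_le_exp_half_sq τ) m).trans_eq ?_
    rw [← Real.exp_nat_mul]
    ring_nf
  have h4 : ((Finset.univ.filter fun z => τ * m ≤ S z).card : ℝ) * Real.exp (τ ^ 2 * m) ≤
      ∑ z : Fin m → Fin 2, Real.exp (τ * S z) := by
    rw [← nsmul_eq_mul]
    refine (Finset.card_nsmul_le_sum _ (fun z => Real.exp (τ * S z)) _ fun z hz => ?_).trans
      (Finset.sum_le_sum_of_subset_of_nonneg (Finset.filter_subset _ _)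
        fun _ _ _ => (Real.exp_pos _).le)
    rw [Finset.mem_filter] at hz
    exact Real.exp_le_exp.2 (by nlinarith [hz.2])
  have h5 : (2 : ℝ) ^ m * Real.exp (-(τ ^ 2 * m / 2)) * Real.exp (τ ^ 2 * m) =
      2 ^ m * Real.exp (τ ^ 2 * m / 2) := by
    rw [mul_assoc, ← Real.exp_add]
    ring_nf
  exact le_of_mul_le_mul_right ((h4.trans h1).trans_eq h5.symm) (Real.exp_pos _)

lemma card_unbalanced_le {m : ℕ} (τ : ℝ) (hτ : 0 ≤ τ) :
    ((Finset.univ.filter fun z : Fin m → Fin 2 => ¬ ∀ k : Fin 2,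
      |2 * ((Finset.univ.filter fun j => z j = k).card : ℝ) - m| ≤ τ * m).card : ℝ) ≤
      2 ^ m * (2 * Real.exp (-(τ ^ 2 * m / 2))) := by
  have h0 := card_large_community_le (m := m) τ hτ 0
  have h1 := card_large_community_le (m := m) τ hτ 1
  refine le_trans ?_ ((add_le_add h0 h1).trans_eq (by ring))
  rw [← Nat.cast_add, Nat.cast_le]
  refine le_trans (Finset.card_le_card fun z hz => ?_) (Finset.card_union_le _ _)
  simp only [Finset.mem_union, Finset.mem_filter, Finset.mem_univ, true_and] at hz ⊢
  by_contra! h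
  refine hz fun k => ?_
  have h2 : ∑ j, (if z j = 1 then (1 : ℝ) else -1) = -∑ j, (if z j = 0 then (1 : ℝ) else -1) := by
    rw [← Finset.sum_neg_distrib]
    refine Finset.sum_congr rfl fun j _ => ?_
    have : z j = 0 ∨ z j = 1 := by omega
    rcases this with h | h <;> simp [h]
  rw [← sum_sign_label, abs_le]
  have : k = 0 ∨ k = 1 := by omega
  rcases this with rfl | rfl <;> constructor <;> linarith [h.1, h.2]

lemma balanced_of_abs_le {n : ℕ} {η : ℝ} (h0 : 0 ≤ η) (h1 : η ≤ 1) {z : Fin n → Fin 2}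
    (hz : ∀ k : Fin 2,
      |2 * ((Finset.univ.filter fun j => z j = k).card : ℝ) - n| ≤ η / 2 * n) :
    Balanced (1 + η) z := by
  intro k
  obtain ⟨h2, h3⟩ := abs_le.1 (hz k)
  have hn : (0 : ℝ) ≤ n := n.cast_nonneg
  constructor
  · push_cast
    rw [div_le_iff₀ (by positivity)]
    nlinarith [mul_nonneg hn h0, mul_nonneg (mul_nonneg hn h0) (sub_nonneg.2 h1)]
  · push_cast
    rw [le_div_iff₀ (by norm_num)]
    nlinarith [mul_nonneg hn h0]

lemma exists_eq_of_balanced {n : ℕ} {α : ℝ} (hn : 0 < n) (hα : 0 < α) {z : Fin n → Fin 2}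
    (hz : Balanced α z) (k : Fin 2) : ∃ j, z j = k := by
  have h : (0 : ℝ) < ((Finset.univ.filter fun i => z i = k).card : ℝ) :=
    lt_of_lt_of_le (by positivity) (hz k).1
  rw [Nat.cast_pos, Finset.card_pos] at h
  obtain ⟨j, hj⟩ := h
  exact ⟨j, (Finset.mem_filter.1 hj).2⟩

lemma symmParam_mem_admissible {n₁ n₂ : ℕ} {c α ρ : ℝ} (hn₁ : 0 < n₁) (hn₂ : 0 < n₂)
    (hc1 : c ≤ 1) (hα : 0 < α) (hρ0 : 0 < ρ) (hρ1 : ρ < 1)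
    {z : Fin n₁ → Fin 2} {z' : Fin n₂ → Fin 2} (hz : Balanced α z) (hz' : Balanced α z') :
    symmParam ρ (c * ρ) z z' ∈ admissible 2 n₁ n₂ c α ρ := by
  refine ⟨⟨ρ, hρ0, hρ1, rfl⟩, hz, hz', ?_⟩
  have hle : ∀ ij : Fin n₁ × Fin n₂,
      (symmParam ρ (c * ρ) z z').edgeProb ij.1 ij.2 ≤ ρ := fun ij => by
    rw [symmParam_edgeProb]
    split_ifs
    · exact le_rfl
    · nlinarith
  obtain ⟨j, hj⟩ := exists_eq_of_balanced hn₂ hα hz' (z ⟨0, hn₁⟩)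
  have : Nonempty (Fin n₁ × Fin n₂) := ⟨(⟨0, hn₁⟩, j)⟩
  refine le_antisymm (ciSup_le hle) ?_
  refine le_ciSup_of_le ⟨ρ, by rintro _ ⟨ij, rfl⟩; exact hle ij⟩ (⟨0, hn₁⟩, j) ?_
  rw [symmParam_edgeProb, if_pos hj.symm]

/-- A hypercube of exactly balanced labellings: a quarter of the rows is paired with another
quarter, each pair carries both labels in an order given by one bit, and the other rows have
fixed labels. -/
lemma exists_hypercube (n : ℕ) :
    ∃ (z : (Fin (n / 4) → Fin 2) → Fin n → Fin 2) (a b : Fin (n / 4) → Fin n)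
      (F : Finset (Fin n)) (f : Fin n → Fin 2),
      Function.Injective a ∧ 2 * (n / 4) ≤ F.card ∧ (∀ s, ∀ i ∈ F, z s i = f i) ∧
      (∀ s k, z s (a k) ≠ z s (b k)) ∧
      (∀ s k, z (Function.update s k (s k + 1)) (a k) = z s (b k)) ∧
      (∀ s k, z (Function.update s k (s k + 1)) (b k) = z s (a k)) ∧
      (∀ s k i, i ≠ a k → i ≠ b k → z (Function.update s k (s k + 1)) i = z s i) ∧
      (∀ s k, |2 * ((Finset.univ.filter fun i => z s i = k).card : ℝ) - n| ≤ 1) := by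
  set t := n / 4 with ht
  set u := n / 2 - t with hu
  set w := n - n / 2 - t with hw
  have e : (Fin t × Fin 2) ⊕ (Fin u ⊕ Fin w) ≃ Fin n := Fintype.equivOfCardEq (by
    simp only [Fintype.card_sum, Fintype.card_prod, Fintype.card_fin]
    omega)
  let lab : (Fin t → Fin 2) → (Fin t × Fin 2) ⊕ (Fin u ⊕ Fin w) → Fin 2 := fun s =>
    Sum.elim (fun x => s x.1 + x.2) (Sum.elim (fun _ => 0) fun _ => 1)
  have hadd : ∀ x : Fin 2, x + 1 + 1 = x := by decide
  refine ⟨fun s i => lab s (e.symm i), fun k => e (Sum.inl (k, 0)), fun k => e (Sum.inl (k, 1)),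
    Finset.univ.map (Function.Embedding.inr.trans e.toEmbedding), fun i => lab 0 (e.symm i),
    ?_, ?_, ?_, ?_, ?_, ?_, ?_, ?_⟩
  · intro k l h
    simpa using h
  · simp only [Finset.card_map, Finset.card_univ, Fintype.card_sum, Fintype.card_fin]
    omega
  · intro s i hi
    obtain ⟨x, -, rfl⟩ := Finset.mem_map.1 hi
    simp [lab]
  · intro s k
    simp [lab]
  · intro s k
    simp [lab]
  · intro s k
    simpa [lab] using hadd (s k)
  · intro s k i hia hib
    obtain ⟨x, rfl⟩ := e.surjective i
    rcases x with ⟨l, β⟩ | x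
    · have hl : l ≠ k := by
        rintro rfl
        have : β = 0 ∨ β = 1 := by omega
        rcases this with rfl | rfl
        · exact hia rfl
        · exact hib rfl
      simp [lab, hl]
    · simp [lab]
  · intro s k
    have hcard : (Finset.univ.filter fun i => lab s (e.symm i) = k).card =
        t + if k = 0 then u else w := by
      rw [Finset.card_filter, e.symm.sum_comp fun x => if lab s x = k then 1 else 0,
        Fintype.sum_sum_type, Fintype.sum_sum_type, Fintype.sum_prod_type]
      have hpair : ∀ x y : Fin 2, ∑ β : Fin 2, (if x + β = y then 1 else 0) = 1 := by decide
      have hpairs : ∑ x : Fin t, ∑ β : Fin 2, (if lab s (Sum.inl (x, β)) = k then 1 else 0) = t :=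
        (Finset.sum_congr rfl fun x _ => hpair (s x) k).trans (by simp)
      rw [hpairs]
      have : k = 0 ∨ k = 1 := by omega
      rcases this with rfl | rfl <;> simp [lab]
    rw [hcard]
    have h1 : 2 * (t + if k = 0 then u else w) ≤ n + 1 ∧
        n ≤ 2 * (t + if k = 0 then u else w) + 1 := by
      split_ifs <;> omega
    have h2 : (2 : ℝ) * ((t + if k = 0 then u else w : ℕ) : ℝ) ≤ n + 1 := by exact_mod_cast h1.1
    have h3 : (n : ℝ) ≤ 2 * ((t + if k = 0 then u else w : ℕ) : ℝ) + 1 := by exact_mod_cast h1.2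
    rw [abs_le]
    constructor <;> linarith

/-- Averaged over the column labels, the risk exceeds the worst-case risk at most by the proportion
of unbalanced column labellings. -/
lemma sum_graphLaw_mul_misclust_le {n₁ n₂ : ℕ} {c η ρ : ℝ} (hn₁ : 0 < n₁) (hn₂ : 0 < n₂)
    (hc0 : 0 ≤ c) (hc1 : c ≤ 1) (hη0 : 0 ≤ η) (hη1 : η ≤ 1) (hρ0 : 0 < ρ) (hρ1 : ρ < 1)
    {z : Fin n₁ → Fin 2} (hz : Balanced (1 + η) z) (zhat : Graph n₁ n₂ → Fin n₁ → Fin 2) :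
    ∑ A, graphLaw ρ (c * ρ) z A * misclust (zhat A) z ≤
      (⨆ θ : admissible 2 n₁ n₂ c (1 + η) ρ, risk zhat θ.1) +
        2 * Real.exp (-(η ^ 2 * n₂ / 8)) := by
  set M := ⨆ θ : admissible 2 n₁ n₂ c (1 + η) ρ, risk zhat θ.1 with hM
  have hM0 : 0 ≤ M := Real.iSup_nonneg fun θ => risk_nonneg _ _
  set U : Finset (Fin n₂ → Fin 2) := Finset.univ.filter fun z' => ¬ ∀ k : Fin 2,
    |2 * ((Finset.univ.filter fun j => z' j = k).card : ℝ) - n₂| ≤ η / 2 * n₂ with hU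
  have hrisk : ∀ z' : Fin n₂ → Fin 2,
      risk zhat (symmParam ρ (c * ρ) z z') ≤ M + if z' ∈ U then 1 else 0 := by
    intro z'
    split_ifs with h
    · linarith [risk_le_one zhat (symmParam ρ (c * ρ) z z')]
    · simp only [hU, Finset.mem_filter, Finset.mem_univ, true_and, not_not] at h
      rw [add_zero]
      exact le_ciSup (f := fun θ : admissible 2 n₁ n₂ c (1 + η) ρ => risk zhat θ.1)
        ⟨1, by rintro _ ⟨θ, rfl⟩; exact risk_le_one _ _⟩
        ⟨_, symmParam_mem_admissible hn₁ hn₂ hc1 (by linarith) hρ0 hρ1 hz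
          (balanced_of_abs_le hη0 hη1 h)⟩
  have hsum : ∑ z' : Fin n₂ → Fin 2, risk zhat (symmParam ρ (c * ρ) z z') =
      2 ^ n₂ * ∑ A, graphLaw ρ (c * ρ) z A * misclust (zhat A) z := by
    simp_rw [risk_eq_sum]
    rw [Finset.sum_comm, Finset.mul_sum]
    refine Finset.sum_congr rfl fun A _ => ?_
    rw [← mul_assoc, ← sum_law_symmParam (mul_nonneg hc0 hρ0.le) (by nlinarith) hρ1.le,
      Finset.sum_mul]
    rfl
  have hUcard : (U.card : ℝ) ≤ 2 ^ n₂ * (2 * Real.exp (-(η ^ 2 * n₂ / 8))) := by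
    refine (card_unbalanced_le (m := n₂) (η / 2) (by linarith)).trans_eq ?_
    ring_nf
  have hle := Finset.sum_le_sum fun z' (_ : z' ∈ Finset.univ) => hrisk z'
  rw [hsum, Finset.sum_add_distrib, Finset.sum_boole] at hle
  simp only [Finset.sum_const, Finset.card_univ, Fintype.card_fun, Fintype.card_fin, nsmul_eq_mul,
    Nat.cast_pow, Nat.cast_ofNat, Finset.filter_mem_eq_inter, Finset.univ_inter] at hle
  refine le_of_mul_le_mul_left (a := (2 : ℝ) ^ n₂) ?_ (by positivity)
  rw [mul_add]
  linarith

lemma sum_update_add_one {t : ℕ} (k : Fin t) (g : (Fin t → Fin 2) → ℝ) :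
    ∑ s, g (Function.update s k (s k + 1)) = ∑ s, g s := by
  have hadd : ∀ x : Fin 2, x + 1 + 1 = x := by decide
  have hinv : Function.Involutive fun s : Fin t → Fin 2 => Function.update s k (s k + 1) :=
    fun s => by simp [hadd]
  exact Equiv.sum_comp hinv.toPerm g

/-- The Bayes risk for a bit of a uniform hypercube. -/
lemma sum_bit_error_ge {V : Type*} [Fintype V] {t : ℕ} (k : Fin t)
    (P : (Fin t → Fin 2) → V → ℝ) (hP : ∀ s v, 0 ≤ P s v) (x : (Fin t → Fin 2) → Fin 2)
    (hx : ∀ s, x (Function.update s k (s k + 1)) ≠ x s) {ε : ℝ}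
    (hε : ∀ s, ε ≤ ∑ v, min (P s v) (P (Function.update s k (s k + 1)) v)) (g : V → Fin 2) :
    2 ^ t * (ε / 2) ≤ ∑ s, ∑ v, P s v * if g v ≠ x s then 1 else 0 := by
  set E : (Fin t → Fin 2) → ℝ := fun s => ∑ v, P s v * if g v ≠ x s then 1 else 0 with hE
  have h1 : ∀ s, ε ≤ E s + E (Function.update s k (s k + 1)) := fun s => by
    refine (hε s).trans ?_
    simp only [hE]
    rw [← Finset.sum_add_distrib]
    refine Finset.sum_le_sum fun v _ => ?_
    by_cases hv : g v = x s
    · have : g v ≠ x (Function.update s k (s k + 1)) := fun h => hx s (h.symm.trans hv)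
      rw [if_pos this, mul_one]
      exact (min_le_right _ _).trans (le_add_of_nonneg_left
        (mul_nonneg (hP _ _) (by split_ifs <;> norm_num)))
    · rw [if_pos hv, mul_one]
      exact (min_le_left _ _).trans (le_add_of_nonneg_right
        (mul_nonneg (hP _ _) (by split_ifs <;> norm_num)))
  have h2 := Finset.sum_le_sum fun s (_ : s ∈ Finset.univ) => h1 s
  rw [Finset.sum_add_distrib, sum_update_add_one k E] at h2
  simp only [Finset.sum_const, Finset.card_univ, Fintype.card_fun, Fintype.card_fin, nsmul_eq_mul,
    Nat.cast_pow, Nat.cast_ofNat] at h2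
  linarith

lemma le_minimaxRisk {n₁ n₂ : ℕ} {c η ρ : ℝ} (hn₁ : 0 < n₁) (hn₂ : 0 < n₂)
    (hc0 : 0 ≤ c) (hc1 : c ≤ 1) (hη0 : 0 ≤ η) (hη1 : η ≤ 1) (hρ0 : 0 < ρ) (hρ1 : ρ < 1)
    (hηn : 1 ≤ η / 2 * n₁) (hsmall : n₁ * ρ ^ 2 ≤ 1 / 4) :
    ((n₁ / 4 : ℕ) : ℝ) / n₁ * (Real.exp (-8 * (n₁ * n₂ * ρ ^ 2)) / 4) -
      2 * Real.exp (-(η ^ 2 * n₂ / 8)) ≤ minimaxRisk 2 n₁ n₂ c (1 + η) ρ := by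
  have hcube := exists_hypercube n₁
  set t := n₁ / 4
  obtain ⟨z, a, b, F, f, ha, hF, hzF, hab, hfa, hfb, hfi, hbal⟩ := hcube
  have hq0 : 0 ≤ c * ρ := mul_nonneg hc0 hρ0.le
  have hqp : c * ρ ≤ ρ := by nlinarith
  refine le_ciInf fun zhat => ?_
  set M := ⨆ θ : admissible 2 n₁ n₂ c (1 + η) ρ, risk zhat θ.1 with hM
  set ε := Real.exp (-8 * (n₁ * n₂ * ρ ^ 2)) / 2 with hε
  set P : (Fin t → Fin 2) → Graph n₁ n₂ → ℝ := fun s => graphLaw ρ (c * ρ) (z s) with hP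
  have hP0 : ∀ s A, 0 ≤ P s A := fun s A => graphLaw_nonneg hq0 hqp hρ1.le _ _
  choose w hw using fun A => exists_aligned (zhat A) f F hF ha
  have hup : ∀ s, ∑ A, P s A * misclust (zhat A) (z s) ≤
      M + 2 * Real.exp (-(η ^ 2 * n₂ / 8)) := fun s =>
    sum_graphLaw_mul_misclust_le hn₁ hn₂ hc0 hc1 hη0 hη1 hρ0 hρ1
      (balanced_of_abs_le hη0 hη1 fun k => (hbal s k).trans hηn) zhat
  have hbit : ∀ k, 2 ^ t * (ε / 2) ≤
      ∑ s, ∑ A, P s A * if w A (a k) ≠ z s (a k) then 1 else 0 := fun k =>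
    sum_bit_error_ge k P hP0 (fun s => z s (a k))
      (fun s => by rw [hfa]; exact (hab s k).symm)
      (fun s => exp_le_sum_min_graphLaw hq0 hqp hρ1.le hsmall (hab s k) (hfa s k) (hfb s k)
        (hfi s k)) (fun A => w A (a k))
  have hlow : ∀ s, ∑ k, ∑ A, P s A * (if w A (a k) ≠ z s (a k) then (1 : ℝ) else 0) ≤
      n₁ * ∑ A, P s A * misclust (zhat A) (z s) := fun s => by
    rw [Finset.sum_comm, Finset.mul_sum]
    refine Finset.sum_le_sum fun A _ => ?_
    rw [← Finset.mul_sum, Finset.sum_boole, mul_left_comm]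
    exact mul_le_mul_of_nonneg_left (hw A (z s) (hzF s)) (hP0 s A)
  have h1 : (t : ℝ) * (2 ^ t * (ε / 2)) ≤
      2 ^ t * (n₁ * (M + 2 * Real.exp (-(η ^ 2 * n₂ / 8)))) := by
    calc (t : ℝ) * (2 ^ t * (ε / 2)) = ∑ _k : Fin t, 2 ^ t * (ε / 2) := by simp
      _ ≤ ∑ k : Fin t, ∑ s, ∑ A, P s A * (if w A (a k) ≠ z s (a k) then (1 : ℝ) else 0) :=
          Finset.sum_le_sum fun k _ => hbit k
      _ = ∑ s, ∑ k : Fin t, ∑ A, P s A * (if w A (a k) ≠ z s (a k) then (1 : ℝ) else 0) :=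
          Finset.sum_comm
      _ ≤ ∑ _s : Fin t → Fin 2, n₁ * (M + 2 * Real.exp (-(η ^ 2 * n₂ / 8))) :=
          Finset.sum_le_sum fun s _ => (hlow s).trans
            (mul_le_mul_of_nonneg_left (hup s) (Nat.cast_nonneg _))
      _ = _ := by simp
  have h2 : (t : ℝ) * (ε / 2) ≤ n₁ * (M + 2 * Real.exp (-(η ^ 2 * n₂ / 8))) := by
    refine le_of_mul_le_mul_left (a := (2 : ℝ) ^ t) ?_ (by positivity)
    linarith
  rw [sub_le_iff_le_add, div_mul_eq_mul_div, div_le_iff₀ (by exact_mod_cast hn₁)]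
  rw [hε] at h2
  linarith

lemma exp_div_le_minimaxRisk {n₁ n₂ : ℕ} {c B C δ ρ : ℝ} (hc0 : 0 ≤ c) (hc1 : c ≤ 1)
    (hB : 0 < B) (hC : 0 < C) (hδ : 0 < δ) (hρ0 : 0 < ρ) (hρ1 : ρ < 1)
    (hδC : C * δ ≤ 1 / 4) (hδB : (8 * C + 5) * (8 * δ) ≤ B ^ 2)
    (hn₁ : 6 ≤ n₁) (hL : 1 ≤ Real.log n₁) (hBL : B ^ 2 * Real.log n₁ ≤ n₁)
    (hBn : 4 ≤ B ^ 2 * n₁) (hn₂ : n₁ * Real.log n₁ ≤ δ * n₂)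
    (hx : n₁ * n₂ * ρ ^ 2 ≤ C * Real.log n₁) :
    Real.exp (-8 * (n₁ * n₂ * ρ ^ 2)) / 64 ≤ minimaxRisk 2 n₁ n₂ c (balanceParam B n₁) ρ := by
  set L := Real.log n₁ with hLdef
  set η := B * √(L / n₁) with hη
  have hn6 : (6 : ℝ) ≤ n₁ := by exact_mod_cast hn₁
  have hn0 : (0 : ℝ) < n₁ := by linarith
  have hη0 : 0 ≤ η := by positivity
  have hηsq : η ^ 2 = B ^ 2 * (L / n₁) := by
    rw [hη, mul_pow, Real.sq_sqrt (by positivity)]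
  have hn₂0 : (0 : ℝ) < n₂ := by
    have : 0 < n₁ * L := by positivity
    exact pos_of_mul_pos_right (this.trans_le hn₂) hδ.le
  have hη1 : η ≤ 1 := by
    rw [← sq_le_one_iff₀ hη0, hηsq, ← mul_div_assoc, div_le_one hn0]
    exact hBL
  have hηn : 1 ≤ η / 2 * n₁ := by
    rw [← one_le_sq_iff₀ (by positivity), mul_pow, div_pow, hηsq]
    have : B ^ 2 * (L / n₁) / 2 ^ 2 * (n₁ : ℝ) ^ 2 = B ^ 2 * n₁ * L / 4 := by
      field_simp
      ring
    rw [this]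
    nlinarith
  have hsmall : n₁ * ρ ^ 2 ≤ 1 / 4 := by
    have h1 : n₁ * ρ ^ 2 * (n₁ * L) ≤ C * δ * L := by
      calc n₁ * ρ ^ 2 * (n₁ * L) ≤ n₁ * ρ ^ 2 * (δ * n₂) := by gcongr
        _ = δ * (n₁ * n₂ * ρ ^ 2) := by ring
        _ ≤ δ * (C * L) := by gcongr
        _ = C * δ * L := by ring
    have h2 : n₁ * ρ ^ 2 * n₁ ≤ C * δ :=
      le_of_mul_le_mul_right (by linarith) (show 0 < L by linarith)
    have h3 : 0 ≤ n₁ * ρ ^ 2 := by positivity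
    nlinarith [h2.trans hδC]
  have htail : 8 * (n₁ * n₂ * ρ ^ 2) + 5 ≤ η ^ 2 * n₂ / 8 := by
    have h1 : (8 * C + 5) * L ≤ η ^ 2 * n₂ / 8 := by
      rw [hηsq]
      have h2 : L ≤ δ * n₂ / n₁ := by
        rw [le_div_iff₀ hn0]
        linarith
      have h3 : L ≤ L * L := by nlinarith
      calc (8 * C + 5) * L ≤ (8 * C + 5) * (L * (δ * n₂ / n₁)) := by
            have : L * L ≤ L * (δ * n₂ / n₁) := by gcongr
            gcongr
            linarith
        _ = (8 * C + 5) * (8 * δ) * (L / n₁ * n₂ / 8) := by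
            field_simp
        _ ≤ B ^ 2 * (L / n₁ * n₂ / 8) := by gcongr
        _ = _ := by ring
    nlinarith
  have hmain := le_minimaxRisk (n₂ := n₂) (by omega) (by exact_mod_cast hn₂0) hc0 hc1 hη0 hη1
    hρ0 hρ1 hηn hsmall
  have hquarter : (1 : ℝ) / 8 ≤ ((n₁ / 4 : ℕ) : ℝ) / n₁ := by
    rw [le_div_iff₀ hn0]
    have h1 : n₁ ≤ 8 * (n₁ / 4) := by omega
    have h2 : (n₁ : ℝ) ≤ 8 * ((n₁ / 4 : ℕ) : ℝ) := by exact_mod_cast h1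
    linarith
  have hexp : 2 * Real.exp (-(η ^ 2 * n₂ / 8)) ≤ Real.exp (-8 * (n₁ * n₂ * ρ ^ 2)) / 64 := by
    have h1 : Real.exp (-(η ^ 2 * n₂ / 8)) * Real.exp 5 ≤ Real.exp (-8 * (n₁ * n₂ * ρ ^ 2)) := by
      rw [← Real.exp_add]
      exact Real.exp_le_exp.2 (by linarith)
    have h2 : (128 : ℝ) ≤ Real.exp 5 := by
      have h3 : Real.exp 5 = Real.exp 1 ^ 5 := by
        rw [← Real.exp_nat_mul]
        norm_num
      rw [h3]
      refine le_trans ?_ (pow_le_pow_left₀ (by norm_num) Real.exp_one_gt_d9.le 5)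
      norm_num
    nlinarith [Real.exp_pos (-(η ^ 2 * n₂ / 8))]
  have hquarter' := mul_le_mul_of_nonneg_right hquarter
    (show 0 ≤ Real.exp (-8 * (n₁ * n₂ * ρ ^ 2)) / 4 by positivity)
  change _ ≤ minimaxRisk 2 n₁ n₂ c (1 + η) ρ
  linarith

lemma eventually_exp_div_le_minimaxRisk {c B : ℝ} (hc0 : 0 ≤ c) (hc1 : c ≤ 1) (hB : 0 < B)
    {n₁ n₂ : ℕ → ℕ} {ρ : ℕ → ℝ} (hρ : ∀ m, 0 < ρ m ∧ ρ m < 1) (hn₁ : Tendsto n₁ atTop atTop)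
    (ho : (fun m => (n₁ m : ℝ) * Real.log (n₁ m)) =o[atTop] (fun m => (n₂ m : ℝ)))
    (hO : (fun m => (n₁ m : ℝ) * n₂ m * ρ m ^ 2) =O[atTop] (fun m => Real.log (n₁ m))) :
    ∀ᶠ m in atTop, Real.exp (-8 * ((n₁ m : ℝ) * n₂ m * ρ m ^ 2)) / 64 ≤
      minimaxRisk 2 (n₁ m) (n₂ m) c (balanceParam B (n₁ m)) (ρ m) := by
  obtain ⟨C, hC, hCO⟩ := hO.exists_pos
  obtain ⟨δ, hδ, hδC, hδB⟩ : ∃ δ : ℝ, 0 < δ ∧ C * δ ≤ 1 / 4 ∧ (8 * C + 5) * (8 * δ) ≤ B ^ 2 := by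
    refine ⟨min (1 / (4 * C)) (B ^ 2 / (8 * (8 * C + 5))), by positivity, ?_, ?_⟩
    · refine (mul_le_mul_of_nonneg_left (min_le_left _ _) hC.le).trans_eq ?_
      field_simp
    · refine (mul_le_mul_of_nonneg_left (mul_le_mul_of_nonneg_left (min_le_right _ _)
        (by norm_num)) (by positivity)).trans_eq ?_
      field_simp
  have hcast : Tendsto (fun m => (n₁ m : ℝ)) atTop atTop := tendsto_natCast_atTop_atTop.comp hn₁
  have hlog : Tendsto (fun m => Real.log (n₁ m)) atTop atTop := Real.tendsto_log_atTop.comp hcast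
  have hlo := (Real.isLittleO_log_id_atTop.comp_tendsto hcast).bound
    (show 0 < 1 / B ^ 2 by positivity)
  filter_upwards [hCO.bound, ho.bound hδ, hlo, hn₁.eventually_ge_atTop 6,
    hlog.eventually_ge_atTop 1, hcast.eventually_ge_atTop (4 / B ^ 2)] with m h1 h2 h3 h4 h5 h6
  have hL : 0 ≤ Real.log (n₁ m) := by linarith
  simp only [Function.comp_apply, id_eq, Real.norm_eq_abs, Nat.abs_cast, abs_of_nonneg hL,
    abs_mul, abs_pow, abs_of_pos (hρ m).1] at h1 h2 h3
  refine exp_div_le_minimaxRisk hc0 hc1 hB hC hδ (hρ m).1 (hρ m).2 hδC hδB h4 h5 ?_ ?_ h2 h1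
  · rw [one_div, inv_mul_eq_div, le_div_iff₀ (by positivity)] at h3
    linarith
  · rw [div_le_iff₀ (by positivity)] at h6
    linarith

end BiSBM

end

theorem mainTheorem2 :
    (∃ c₁ : ℝ, 0 < c₁ ∧
      ∀ c : ℝ, 0 < c → c < 1 → ∀ B : ℝ, 0 < B →
      ∀ (n₁ n₂ : ℕ → ℕ) (ρ : ℕ → ℝ),
        (∀ m, 0 < ρ m ∧ ρ m < 1) →
        (fun m => (n₁ m : ℝ) * Real.log (n₁ m)) =o[atTop] (fun m => (n₂ m : ℝ)) →
        Tendsto (fun m => (n₁ m : ℝ) * n₂ m * ρ m ^ 2) atTop atTop →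
        (fun m => (n₁ m : ℝ) * n₂ m * ρ m ^ 2) =O[atTop] (fun m => Real.log (n₁ m)) →
        ∀ᶠ m in atTop,
          Real.exp (-c₁ * ((n₁ m : ℝ) * n₂ m * ρ m ^ 2)) ≤
            BiSBM.minimaxRisk 2 (n₁ m) (n₂ m) c (BiSBM.balanceParam B (n₁ m)) (ρ m)) ∧
    (∀ a b : ℝ, 0 < a → a ≤ b → ∃ c₂ : ℝ, 0 < c₂ ∧
      ∀ c : ℝ, 0 < c → c < 1 → ∀ B : ℝ, 0 < B →
      ∀ (n₁ n₂ : ℕ → ℕ) (ρ : ℕ → ℝ),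
        (∀ m, 0 < ρ m ∧ ρ m < 1) →
        Tendsto n₁ atTop atTop →
        (fun m => (n₁ m : ℝ) * Real.log (n₁ m)) =o[atTop] (fun m => (n₂ m : ℝ)) →
        (∀ᶠ m in atTop, a ≤ (n₁ m : ℝ) * n₂ m * ρ m ^ 2 ∧
          (n₁ m : ℝ) * n₂ m * ρ m ^ 2 ≤ b) →
        ∀ᶠ m in atTop,
          c₂ ≤ BiSBM.minimaxRisk 2 (n₁ m) (n₂ m) c (BiSBM.balanceParam B (n₁ m)) (ρ m)) := by
  refine ⟨⟨9, by norm_num, ?_⟩, fun a b ha hab => ⟨Real.exp (-8 * b) / 64, by positivity, ?_⟩⟩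
  · intro c hc0 hc1 B hB n₁ n₂ ρ hρ ho hx hO
    have hlog : Tendsto (fun m => Real.log (n₁ m)) atTop atTop := by
      obtain ⟨C, hC, hCO⟩ := hO.exists_pos
      have h1 : Tendsto (fun m => C * Real.log (n₁ m)) atTop atTop := by
        refine tendsto_atTop_mono' _ ?_ hx
        filter_upwards [hCO.bound] with m hm
        rw [Real.norm_of_nonneg (Real.log_natCast_nonneg _)] at hm
        exact (le_abs_self _).trans hm
      exact (tendsto_const_mul_atTop_of_pos hC).1 h1
    have hn₁ : Tendsto n₁ atTop atTop := by
      rw [← tendsto_natCast_atTop_iff (R := ℝ)]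
      refine tendsto_atTop_mono (fun m => ?_) hlog
      exact Real.log_le_self (Nat.cast_nonneg _)
    filter_upwards [BiSBM.eventually_exp_div_le_minimaxRisk hc0.le hc1.le hB hρ hn₁ ho hO,
      hx.eventually_ge_atTop (Real.log 64)] with m h1 h2
    refine le_trans ?_ h1
    have h3 : (64 : ℝ) ≤ Real.exp ((n₁ m : ℝ) * n₂ m * ρ m ^ 2) := by
      rwa [← Real.log_le_iff_le_exp (by norm_num)]
    have h4 : Real.exp (-9 * ((n₁ m : ℝ) * n₂ m * ρ m ^ 2)) *
        Real.exp ((n₁ m : ℝ) * n₂ m * ρ m ^ 2) =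
          Real.exp (-8 * ((n₁ m : ℝ) * n₂ m * ρ m ^ 2)) := by
      rw [← Real.exp_add]
      ring_nf
    rw [le_div_iff₀ (by norm_num), ← h4]
    gcongr
  · intro c hc0 hc1 B hB n₁ n₂ ρ hρ hn₁ ho hx
    have hlog : Tendsto (fun m => Real.log (n₁ m)) atTop atTop :=
      Real.tendsto_log_atTop.comp (tendsto_natCast_atTop_atTop.comp hn₁)
    have hO : (fun m => (n₁ m : ℝ) * n₂ m * ρ m ^ 2) =O[atTop] (fun m => Real.log (n₁ m)) := by
      refine IsBigO.of_bound b ?_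
      filter_upwards [hx, hlog.eventually_ge_atTop 1] with m h1 h2
      rw [Real.norm_of_nonneg (ha.le.trans h1.1), Real.norm_of_nonneg (by linarith)]
      nlinarith [h1.2]
    filter_upwards [BiSBM.eventually_exp_div_le_minimaxRisk hc0.le hc1.le hB hρ hn₁ ho hO, hx]
      with m h1 h2
    refine le_trans ?_ h1
    gcongr ?_ / 64
    exact Real.exp_le_exp.2 (by linarith [h2.2])
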